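/- Let $\ell\ge 2$ and $t\ge 2$ be integers. There exists a constant $C=C(\ell,t)>0$, depending only on $\ell$ and $t$, such that the following holds for all $s$ and $n$. Let $K=2^{4\ell+2}$ and let $G$ be a (finite, simple) $n$-vertex graph which is $K$-almost-regular, i.e. $\Delta(G)\le K\,\delta(G)$, and contains no (not necessarily induced) subgraph isomorphic to the complete bipartite graph $K_{s,s}$. If $$e(G) > C\,(\ell t)^{20s}\, n^{1+\frac1\ell},$$ then at least a $1-\frac{1}{2t^2}$ fraction of the graph homomorphisms $\varphi\colon C_{2\ell}\to G$ (equivalently, of the closed walks with $2\ell$ edges in $G$, with a starting point and a direction) are induced $2\ell$-cycles, that is, the $2\ell$ vertices $\varphi(v_0),\dots,\varphi(v_{2\ell-1})$ are pairwise distinct and the only edges of $G$ among them are the $2\ell$ edges $\varphi(v_i)\varphi(v_{i+1})$ (indices modulo $2\ell$). -/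

import Mathlib

/-- `G` is `K`-almost-regular: `Δ(G) ≤ K δ(G)`. -/
def IsAlmostRegular {V : Type*} [Fintype V] (G : SimpleGraph V) [DecidableRel G.Adj]
    (K : ℝ) : Prop :=
  (G.maxDegree : ℝ) ≤ K * (G.minDegree : ℝ)

/-- `Hom(C_k, G)`: the homomorphic `k`-cycles, i.e. the closed `k`-walks
(with a base point and an orientation) of `G`. -/
abbrev HomCycle {V : Type*} (G : SimpleGraph V) (k : ℕ) : Type _ :=
  SimpleGraph.cycleGraph k →g G

/-- The homomorphic `k`-cycle `φ` is an induced `k`-cycle of `G`: its `k` vertices are pairwise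
distinct, and the only edges of `G` among them are those of the cycle. -/
def HomCycle.IsInduced {V : Type*} {G : SimpleGraph V} {k : ℕ} (φ : HomCycle G k) : Prop :=
  Function.Injective φ ∧
    ∀ i j : Fin k, G.Adj (φ i) (φ j) → (SimpleGraph.cycleGraph k).Adj i j

/-!
Let `A` be the adjacency matrix and `T k = tr (A ^ (2 * k))`, the number of closed walks of length
`2 * k`. Since `A` is symmetric, `k ↦ (A ^ (2 * k)) v v` is log-convex for every vertex `v`.

A closed walk of length `2 * l` that visits a vertex twice splits there into two closed walks, so
by log-convexity the walks with a given pair of coinciding positions number at most `Δ * T (l - 1)`.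

For a given chord, with ends `u` and `v`, choose a position on each of the two arcs between the
chord's ends so that the two arcs joining the chosen positions have length `l`, and fix the images
`a` and `b` of these positions. The walks are then counted by the edges `u v`, where `u` carries the
weight `A ^ i a u * A ^ i' u b` of the `l`-step walks from `a` to `b` through it, and `v` a similar
weight. A weighted Kővári–Sós–Turán theorem bounds this by a small proportion of the squared total
weight `(A ^ l) a b ^ 2`, which contributes to `T l`, up to sums of squared weights, which count
walks that visit `u` or `v` twice and hence are again controlled by `Δ * T (l - 1)`.

Finally, log-convexity gives `T (l - 1) ^ l ≤ T 0 * T l ^ (l - 1)`, and `T 0` is the number of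
vertices, so that density and almost-regularity make `Δ * T (l - 1)` small compared to `T l`.
-/

open scoped Finset

/-- A log-convex sequence of nonnegative reals, such as the sequence of even moments of a
symmetric matrix. Zero terms are allowed. -/
structure IsLogConvex (b : ℕ → ℝ) : Prop where
  nonneg : ∀ n, 0 ≤ b n
  sq_le : ∀ n, b (n + 1) ^ 2 ≤ b n * b (n + 2)

namespace IsLogConvex

variable {b : ℕ → ℝ}

lemma succ_eq_zero (hb : IsLogConvex b) {n : ℕ} (h : b n = 0) : b (n + 1) = 0 := by
  have hsq := hb.sq_le n
  rw [h, zero_mul] at hsq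
  exact pow_eq_zero_iff two_ne_zero |>.1 (le_antisymm hsq (sq_nonneg _))

lemma succ_mul_add_le (hb : IsLogConvex b) (m d : ℕ) :
    b (m + 1) * b (m + d) ≤ b m * b (m + d + 1) := by
  induction d generalizing m with
  | zero => simp [mul_comm]
  | succ d ih =>
    rcases (hb.nonneg (m + 1)).eq_or_lt with h0 | hpos
    · rw [← h0, zero_mul]
      exact mul_nonneg (hb.nonneg _) (hb.nonneg _)
    have ih' : b (m + 2) * b (m + (d + 1)) ≤ b (m + 1) * b (m + (d + 1) + 1) := by
      simpa only [add_assoc, add_comm, add_left_comm, one_add_one_eq_two] using ih (m + 1)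
    refine le_of_mul_le_mul_left ?_ hpos
    calc b (m + 1) * (b (m + 1) * b (m + (d + 1)))
        = b (m + 1) ^ 2 * b (m + (d + 1)) := by ring
      _ ≤ b m * b (m + 2) * b (m + (d + 1)) :=
          mul_le_mul_of_nonneg_right (hb.sq_le m) (hb.nonneg _)
      _ = b m * (b (m + 2) * b (m + (d + 1))) := by ring
      _ ≤ b m * (b (m + 1) * b (m + (d + 1) + 1)) :=
          mul_le_mul_of_nonneg_left ih' (hb.nonneg _)
      _ = b (m + 1) * (b m * b (m + (d + 1) + 1)) := by ring

theorem add_mul_add_le (hb : IsLogConvex b) (k i j : ℕ) :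
    b (k + i) * b (k + j) ≤ b k * b (k + i + j) := by
  induction i with
  | zero => simp
  | succ i ih =>
    rw [← add_assoc, add_right_comm _ 1 j]
    rcases (hb.nonneg (k + i)).eq_or_lt with h0 | hpos
    · rw [hb.succ_eq_zero h0.symm, zero_mul]
      exact mul_nonneg (hb.nonneg _) (hb.nonneg _)
    refine le_of_mul_le_mul_left ?_ hpos
    calc b (k + i) * (b (k + i + 1) * b (k + j))
        = b (k + i) * b (k + j) * b (k + i + 1) := by ring
      _ ≤ b k * b (k + i + j) * b (k + i + 1) :=
          mul_le_mul_of_nonneg_right ih (hb.nonneg _)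
      _ = b k * (b (k + i + 1) * b (k + i + j)) := by ring
      _ ≤ b k * (b (k + i) * b (k + i + j + 1)) :=
          mul_le_mul_of_nonneg_left (hb.succ_mul_add_le _ _) (hb.nonneg _)
      _ = b (k + i) * (b k * b (k + i + j + 1)) := by ring

theorem pow_succ_le (hb : IsLogConvex b) (k : ℕ) :
    b k ^ (k + 1) ≤ b 0 * b (k + 1) ^ k := by
  induction k with
  | zero => simp
  | succ k ih =>
    rcases (hb.nonneg (k + 1)).eq_or_lt with h0 | hpos
    · rw [← h0, zero_pow (by omega)]
      exact mul_nonneg (hb.nonneg _) (pow_nonneg (hb.nonneg _) _)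
    refine le_of_mul_le_mul_left ?_ (pow_pos hpos k)
    calc b (k + 1) ^ k * b (k + 1) ^ (k + 1 + 1) = (b (k + 1) ^ 2) ^ (k + 1) := by ring
      _ ≤ (b k * b (k + 2)) ^ (k + 1) := pow_le_pow_left₀ (sq_nonneg _) (hb.sq_le k) _
      _ = b k ^ (k + 1) * b (k + 2) ^ (k + 1) := by ring
      _ ≤ b 0 * b (k + 1) ^ k * b (k + 2) ^ (k + 1) :=
          mul_le_mul_of_nonneg_right ih (pow_nonneg (hb.nonneg _) _)
      _ = b (k + 1) ^ k * (b 0 * b (k + 2) ^ (k + 1)) := by ring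

/- For `b k = tr (A ^ (2 * k))`, `δ` and `d` are the minimum and maximum degrees and `b 0` is the
number of vertices, so that `hDd` expresses density. -/
theorem mul_mul_le_of_pow_le (hb : IsLogConvex b) {D d δ K : ℝ} {k : ℕ} (hD : 0 ≤ D)
    (hd : 0 ≤ d) (hdδ : d ≤ K * δ) (hδ : δ ^ (2 * (k + 1)) ≤ b (k + 1))
    (hDd : D ^ (k + 1) * b 0 ≤ d ^ (k + 1)) :
    D * (d * b k) ≤ K ^ 2 * b (k + 1) := by
  have hbk := hb.nonneg (k + 1)
  have hKδ : 0 ≤ K * δ := hd.trans hdδ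
  refine le_of_pow_le_pow_left₀ k.succ_ne_zero (by positivity) ?_
  calc (D * (d * b k)) ^ (k + 1) = D ^ (k + 1) * d ^ (k + 1) * b k ^ (k + 1) := by ring
    _ ≤ D ^ (k + 1) * d ^ (k + 1) * (b 0 * b (k + 1) ^ k) := by gcongr; exact hb.pow_succ_le k
    _ = D ^ (k + 1) * b 0 * d ^ (k + 1) * b (k + 1) ^ k := by ring
    _ ≤ d ^ (k + 1) * d ^ (k + 1) * b (k + 1) ^ k := by gcongr
    _ ≤ (K * δ) ^ (k + 1) * (K * δ) ^ (k + 1) * b (k + 1) ^ k := by gcongr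
    _ = (K ^ 2) ^ (k + 1) * δ ^ (2 * (k + 1)) * b (k + 1) ^ k := by ring
    _ ≤ (K ^ 2) ^ (k + 1) * b (k + 1) * b (k + 1) ^ k := by gcongr
    _ = (K ^ 2 * b (k + 1)) ^ (k + 1) := by ring

end IsLogConvex

section SymmetricMatrix

variable {V : Type*} [Fintype V] [DecidableEq V] {A : Matrix V V ℝ}

lemma diag_pow_two_mul (hA : A.IsSymm) (k : ℕ) (v : V) :
    (A ^ (2 * k)) v v = ∑ x, (A ^ k) v x ^ 2 := by
  rw [two_mul, pow_add, Matrix.mul_apply]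
  exact Finset.sum_congr rfl fun x _ => by rw [(hA.pow k).apply v x, sq]

lemma trace_pow_two_mul (hA : A.IsSymm) (k : ℕ) :
    (A ^ (2 * k)).trace = ∑ a, ∑ b, (A ^ k) a b ^ 2 :=
  Finset.sum_congr rfl fun v _ => diag_pow_two_mul hA k v

lemma diag_pow_add_sq_le (hA : A.IsSymm) (i j : ℕ) (v : V) :
    (A ^ (i + j)) v v ^ 2 ≤ (A ^ (2 * i)) v v * (A ^ (2 * j)) v v := by
  rw [diag_pow_two_mul hA, diag_pow_two_mul hA, pow_add, Matrix.mul_apply]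
  simp_rw [fun x => (hA.pow j).apply v x]
  exact Finset.sum_mul_sq_le_sq_mul_sq _ _ _

lemma isLogConvex_diag_pow (hA : A.IsSymm) (v : V) :
    IsLogConvex fun n => (A ^ (2 * n)) v v where
  nonneg n := by
    rw [diag_pow_two_mul hA]
    exact Finset.sum_nonneg fun x _ => sq_nonneg _
  sq_le n := by
    simpa only [show n + (n + 2) = 2 * (n + 1) by ring] using diag_pow_add_sq_le hA n (n + 2) v

lemma isLogConvex_trace_pow (hA : A.IsSymm) : IsLogConvex fun n => (A ^ (2 * n)).trace where
  nonneg n := Finset.sum_nonneg fun v _ => (isLogConvex_diag_pow hA v).nonneg n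
  sq_le n := Finset.sum_sq_le_sum_mul_sum_of_sq_le_mul _
    (fun v _ => (isLogConvex_diag_pow hA v).nonneg n)
    (fun v _ => (isLogConvex_diag_pow hA v).nonneg (n + 2))
    (fun v _ => (isLogConvex_diag_pow hA v).sq_le n)

lemma diag_pow_even_mul_le (hA : A.IsSymm) (v : V) {i j k : ℕ} (hi : 1 ≤ i) (hj : 1 ≤ j)
    (hk : i + j = k + 1) :
    (A ^ (2 * i)) v v * (A ^ (2 * j)) v v ≤ (A ^ 2) v v * (A ^ (2 * k)) v v := by
  obtain ⟨i, rfl⟩ := Nat.exists_eq_add_of_le hi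
  obtain ⟨j, rfl⟩ := Nat.exists_eq_add_of_le hj
  obtain rfl : k = 1 + i + j := by omega
  exact (isLogConvex_diag_pow hA v).add_mul_add_le 1 i j

lemma diag_pow_odd_mul_le (hA : A.IsSymm) (v : V) {i j k : ℕ} (hi : 1 ≤ i) (hj : 1 ≤ j)
    (hk : i + j = k) :
    (A ^ (2 * i + 1)) v v * (A ^ (2 * j + 1)) v v ≤ (A ^ 2) v v * (A ^ (2 * k)) v v := by
  have hnonneg := (isLogConvex_diag_pow hA v).nonneg
  have hi_sq : (A ^ (2 * i + 1)) v v ^ 2 ≤ (A ^ (2 * i)) v v * (A ^ (2 * (i + 1))) v v := by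
    simpa only [← add_assoc, ← two_mul] using diag_pow_add_sq_le hA i (i + 1) v
  have hj_sq : (A ^ (2 * j + 1)) v v ^ 2 ≤ (A ^ (2 * j)) v v * (A ^ (2 * (j + 1))) v v := by
    simpa only [← add_assoc, ← two_mul] using diag_pow_add_sq_le hA j (j + 1) v
  have hR : 0 ≤ (A ^ 2) v v * (A ^ (2 * k)) v v := mul_nonneg (hnonneg 1) (hnonneg k)
  refine (abs_le_of_sq_le_sq' ?_ hR).2
  calc ((A ^ (2 * i + 1)) v v * (A ^ (2 * j + 1)) v v) ^ 2
      = (A ^ (2 * i + 1)) v v ^ 2 * (A ^ (2 * j + 1)) v v ^ 2 := by ring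
    _ ≤ (A ^ (2 * i)) v v * (A ^ (2 * (i + 1))) v v *
        ((A ^ (2 * j)) v v * (A ^ (2 * (j + 1))) v v) :=
        mul_le_mul hi_sq hj_sq (sq_nonneg _) (mul_nonneg (hnonneg _) (hnonneg _))
    _ = (A ^ (2 * i)) v v * (A ^ (2 * (j + 1))) v v *
        ((A ^ (2 * (i + 1))) v v * (A ^ (2 * j)) v v) := by ring
    _ ≤ (A ^ 2) v v * (A ^ (2 * k)) v v * ((A ^ 2) v v * (A ^ (2 * k)) v v) :=
        mul_le_mul (diag_pow_even_mul_le hA v (by omega) (by omega) (by omega))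
          (diag_pow_even_mul_le hA v (by omega) (by omega) (by omega))
          (mul_nonneg (hnonneg _) (hnonneg _)) hR
    _ = ((A ^ 2) v v * (A ^ (2 * k)) v v) ^ 2 := (sq _).symm

lemma diag_pow_mul_diag_pow_le (hA : A.IsSymm) {v : V} (hv : A v v = 0) {m m' k : ℕ}
    (hm : 1 ≤ m) (hm' : 1 ≤ m') (hk : m + m' = 2 * (k + 1)) :
    (A ^ m) v v * (A ^ m') v v ≤ (A ^ 2) v v * (A ^ (2 * k)) v v := by
  have hnonneg := (isLogConvex_diag_pow hA v).nonneg
  have hR : 0 ≤ (A ^ 2) v v * (A ^ (2 * k)) v v := mul_nonneg (hnonneg 1) (hnonneg k)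
  rcases Nat.even_or_odd' m with ⟨i, rfl | rfl⟩
  · obtain ⟨j, rfl⟩ : ∃ j, m' = 2 * j := ⟨k + 1 - i, by omega⟩
    exact diag_pow_even_mul_le hA v (by omega) (by omega) (by omega)
  · obtain ⟨j, rfl⟩ : ∃ j, m' = 2 * j + 1 := ⟨k - i, by omega⟩
    rcases Nat.eq_zero_or_pos i with rfl | hi
    · simpa [hv] using hR
    rcases Nat.eq_zero_or_pos j with rfl | hj
    · simpa [hv] using hR
    exact diag_pow_odd_mul_le hA v hi hj (by omega)

lemma sum_diag_pow_mul_diag_pow_le (hA : A.IsSymm) {d : ℝ} (hd : ∀ v, (A ^ 2) v v ≤ d)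
    (hdiag : ∀ v, A v v = 0) {m m' k : ℕ} (hm : 1 ≤ m) (hm' : 1 ≤ m')
    (hk : m + m' = 2 * (k + 1)) :
    ∑ v, (A ^ m) v v * (A ^ m') v v ≤ d * (A ^ (2 * k)).trace := by
  rw [Matrix.trace, Finset.mul_sum]
  exact Finset.sum_le_sum fun v _ => (diag_pow_mul_diag_pow_le hA (hdiag v) hm hm' hk).trans
    (mul_le_mul_of_nonneg_right (hd v) ((isLogConvex_diag_pow hA v).nonneg k))

lemma sum_diag_pow_even_mul_le (hA : A.IsSymm) {d : ℝ} (hd : ∀ v, (A ^ 2) v v ≤ d)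
    {i j k : ℕ} (hi : 1 ≤ i) (hj : 1 ≤ j) (hk : i + j = k + 1) :
    ∑ v, (A ^ (2 * i)) v v * (A ^ (2 * j)) v v ≤ d * (A ^ (2 * k)).trace := by
  rw [Matrix.trace, Finset.mul_sum]
  exact Finset.sum_le_sum fun v _ => (diag_pow_even_mul_le hA v hi hj hk).trans
    (mul_le_mul_of_nonneg_right (hd v) ((isLogConvex_diag_pow hA v).nonneg k))

lemma pow_le_sum_pow_apply (hA : ∀ a b, 0 ≤ A a b) {δ : ℝ} (hδ : 0 ≤ δ)
    (hrow : ∀ a, δ ≤ ∑ b, A a b) (k : ℕ) (a : V) : δ ^ k ≤ ∑ b, (A ^ k) a b := by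
  induction k with
  | zero => simp [Matrix.one_apply]
  | succ k ih =>
    calc δ ^ (k + 1) ≤ (∑ x, (A ^ k) a x) * δ := by rw [pow_succ]; gcongr
      _ = ∑ x, (A ^ k) a x * δ := Finset.sum_mul ..
      _ ≤ ∑ x, (A ^ k) a x * ∑ b, A x b := Finset.sum_le_sum fun x _ =>
          mul_le_mul_of_nonneg_left (hrow x) (Matrix.pow_apply_nonneg hA k a x)
      _ = ∑ b, (A ^ (k + 1)) a b := by
          simp_rw [pow_succ, Matrix.mul_apply, Finset.mul_sum]
          exact Finset.sum_comm

theorem pow_le_trace_pow [Nonempty V] (hsymm : A.IsSymm) (hA : ∀ a b, 0 ≤ A a b) {δ : ℝ}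
    (hδ : 0 ≤ δ) (hrow : ∀ a, δ ≤ ∑ b, A a b) (k : ℕ) :
    δ ^ (2 * k) ≤ (A ^ (2 * k)).trace := by
  have hcard : 0 < (Fintype.card V : ℝ) := by exact_mod_cast Fintype.card_pos
  have hsum : (Fintype.card V : ℝ) * δ ^ k ≤ ∑ z : V × V, (A ^ k) z.1 z.2 := by
    rw [Fintype.sum_prod_type, ← nsmul_eq_mul]
    exact Finset.card_nsmul_le_sum _ _ _ fun a _ => pow_le_sum_pow_apply hA hδ hrow k a
  have hcauchy : (∑ z : V × V, (A ^ k) z.1 z.2) ^ 2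
      ≤ Fintype.card V * Fintype.card V * (A ^ (2 * k)).trace := by
    rw [trace_pow_two_mul hsymm, ← Nat.cast_mul, ← Fintype.card_prod, ← Fintype.sum_prod_type']
    exact sq_sum_le_card_mul_sum_sq
  refine le_of_mul_le_mul_left ?_ (mul_pos hcard hcard)
  calc (Fintype.card V * Fintype.card V : ℝ) * δ ^ (2 * k)
      = (Fintype.card V * δ ^ k) ^ 2 := by ring
    _ ≤ (∑ z : V × V, (A ^ k) z.1 z.2) ^ 2 := pow_le_pow_left₀ (by positivity) hsum 2
    _ ≤ _ := hcauchy

end SymmetricMatrix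

section KovariSosTuran

lemma card_common_neighbors_lt {V α β : Type*} [Fintype V] [Finite α] [Fintype β]
    {G : SimpleGraph V} (hfree : (completeBipartiteGraph α β).Free G) {u : α → V}
    (hu : Function.Injective u) [DecidablePred fun v => ∀ a, G.Adj (u a) v] :
    #{v | ∀ a, G.Adj (u a) v} < Fintype.card β := by
  have := Fintype.ofFinite α
  by_contra! hcard
  obtain ⟨right, hsub, hright⟩ := Finset.exists_subset_card_eq hcard
  refine hfree (SimpleGraph.completeBipartiteGraph_isContained_iff.2
    ⟨Finset.univ.map ⟨u, hu⟩, right, by simp, hright, ?_⟩)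
  intro x hx v hv
  obtain ⟨a, rfl⟩ : ∃ a, u a = x := by simpa using hx
  exact (Finset.mem_filter.1 (hsub hv)).2 a

variable {V : Type*} [Fintype V] {G : SimpleGraph V} [DecidableRel G.Adj] {s r : ℕ}

/-- The weight `μ` × `ν` of the set of ordered pairs of adjacent vertices of `G`, that is, a
weighted count of the edges between two copies of `V`. -/
noncomputable def edgeWeight (G : SimpleGraph V) [DecidableRel G.Adj] (μ ν : V → ℝ) : ℝ :=
  ∑ u, ∑ v with G.Adj u v, μ u * ν v

lemma edgeWeight_le_mul {μ ν : V → ℝ} (hμ : ∀ v, 0 ≤ μ v) (hν : ∀ v, 0 ≤ ν v) :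
    edgeWeight G μ ν ≤ (∑ u, μ u) * ∑ v, ν v := by
  rw [edgeWeight, Finset.sum_mul_sum]
  exact Finset.sum_le_sum fun u _ => Finset.sum_le_sum_of_subset_of_nonneg
    (Finset.filter_subset _ _) fun v _ _ => mul_nonneg (hμ u) (hν v)

lemma edgeWeight_smul (c : ℝ) (μ ν : V → ℝ) :
    edgeWeight G (c • μ) (c • ν) = c ^ 2 * edgeWeight G μ ν := by
  simp only [edgeWeight, Finset.mul_sum, Pi.smul_apply, smul_eq_mul]
  exact Finset.sum_congr rfl fun u _ => Finset.sum_congr rfl fun v _ => by ring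

lemma sum_prod_filter_apply_eq [DecidableEq V] {μ : V → ℝ} (hμ : ∑ v, μ v = 1) {i j : Fin s}
    (hij : i ≠ j) :
    ∑ u : Fin s → V with u i = u j, ∏ k, μ (u k) = ∑ v, μ v ^ 2 := by
  rw [← Finset.sum_fiberwise _ fun u : Fin s → V => u i]
  refine Finset.sum_congr rfl fun x _ => ?_
  have hfiber : ({u ∈ ({u | u i = u j} : Finset (Fin s → V)) | u i = x})
      = Fintype.piFinset fun k => if k = i ∨ k = j then {x} else Finset.univ := by
    ext u
    simp only [Finset.mem_filter, Finset.mem_univ, true_and, Fintype.mem_piFinset]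
    refine ⟨fun ⟨h, hx⟩ k => ?_, fun h => ?_⟩
    · split_ifs with hk
      · rcases hk with rfl | rfl <;> simp [← hx, h]
      · exact Finset.mem_univ _
    · have hi : u i = x := by simpa using h i
      have hj : u j = x := by simpa using h j
      exact ⟨hi.trans hj.symm, hi⟩
  have hprod : ∀ k, ∑ v ∈ (if k = i ∨ k = j then {x} else Finset.univ), μ v
      = if k ∈ ({i, j} : Finset (Fin s)) then μ x else 1 := fun k => by
    by_cases hk : k = i ∨ k = j <;> simp [hk, hμ]
  rw [hfiber, ← Finset.prod_univ_sum (f := fun _ => μ), Finset.prod_congr rfl fun k _ => hprod k,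
    Finset.prod_ite_mem, Finset.univ_inter, Finset.prod_pair hij, sq]

lemma sum_prod_filter_not_injective_le [DecidableEq V] {μ : V → ℝ} (hμ0 : ∀ v, 0 ≤ μ v)
    (hμ : ∑ v, μ v = 1) :
    ∑ u : Fin s → V with ¬ Function.Injective u, ∏ k, μ (u k) ≤ s ^ 2 * ∑ v, μ v ^ 2 := by
  have hprod : ∀ u : Fin s → V, 0 ≤ ∏ k, μ (u k) := fun u => Finset.prod_nonneg fun k _ => hμ0 _
  have hterm : ∀ u : Fin s → V, (if ¬ Function.Injective u then ∏ k, μ (u k) else 0)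
      ≤ ∑ z ∈ Finset.univ.offDiag, if u z.1 = u z.2 then ∏ k, μ (u k) else 0 := by
    intro u
    have hnonneg : ∀ z ∈ (Finset.univ.offDiag : Finset (Fin s × Fin s)),
        0 ≤ if u z.1 = u z.2 then ∏ k, μ (u k) else 0 := fun z _ => by
      split_ifs
      exacts [hprod u, le_rfl]
    split_ifs with hu
    · exact Finset.sum_nonneg hnonneg
    · obtain ⟨i, j, h, hij⟩ := Function.not_injective_iff.1 hu
      simpa only [if_pos h] using Finset.single_le_sum hnonneg (a := (i, j)) (by simpa using hij)
  calc ∑ u : Fin s → V with ¬ Function.Injective u, ∏ k, μ (u k)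
      ≤ ∑ z ∈ Finset.univ.offDiag, ∑ u : Fin s → V with u z.1 = u z.2, ∏ k, μ (u k) := by
        simp_rw [Finset.sum_filter]
        exact (Finset.sum_le_sum fun u _ => hterm u).trans_eq Finset.sum_comm
    _ = #(Finset.univ.offDiag : Finset (Fin s × Fin s)) * ∑ v, μ v ^ 2 := by
        rw [Finset.sum_congr rfl fun z hz =>
          sum_prod_filter_apply_eq hμ (Finset.mem_offDiag.1 hz).2.2, Finset.sum_const,
          nsmul_eq_mul]
    _ ≤ s ^ 2 * ∑ v, μ v ^ 2 := by
        gcongr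
        exact_mod_cast (Finset.card_le_univ _).trans_eq (by simp [sq])

lemma edgeWeight_pow_le_sum {μ ν : V → ℝ} (hμ0 : ∀ v, 0 ≤ μ v) (hν0 : ∀ v, 0 ≤ ν v)
    (hν : ∑ v, ν v = 1) (s : ℕ) :
    edgeWeight G μ ν ^ s
      ≤ ∑ u : Fin s → V, (∏ k, μ (u k)) * ∑ v with ∀ k, G.Adj (u k) v, ν v := by
  calc edgeWeight G μ ν ^ s = (∑ v, ν v * ∑ u with G.Adj u v, μ u) ^ s := by
        simp_rw [edgeWeight, Finset.mul_sum]
        rw [Finset.sum_comm' (t' := Finset.univ) (s' := fun v => {u | G.Adj u v}) (by simp)]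
        simp_rw [mul_comm]
    _ ≤ ∑ v, ν v * (∑ u with G.Adj u v, μ u) ^ s :=
        Real.pow_arith_mean_le_arith_mean_pow _ _ _ (fun v _ => hν0 v) hν
          (fun v _ => Finset.sum_nonneg fun u _ => hμ0 u) s
    _ = ∑ v, ∑ u : Fin s → V with ∀ k, G.Adj (u k) v, (∏ k, μ (u k)) * ν v := by
        refine Finset.sum_congr rfl fun v _ => ?_
        rw [Finset.sum_pow', ← Finset.sum_mul, mul_comm]
        congr 2
        ext u
        simp [Fintype.mem_piFinset]
    _ = ∑ u : Fin s → V, (∏ k, μ (u k)) * ∑ v with ∀ k, G.Adj (u k) v, ν v := by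
        simp_rw [Finset.mul_sum]
        exact Finset.sum_comm' (by simp)

lemma edgeWeight_pow_le (hfree : (completeBipartiteGraph (Fin s) (Fin r)).Free G) {μ ν : V → ℝ}
    (hμ0 : ∀ v, 0 ≤ μ v) (hν0 : ∀ v, 0 ≤ ν v) (hμ : ∑ v, μ v = 1) (hν : ∑ v, ν v = 1) {M : ℝ}
    (hM0 : 0 ≤ M) (hM : ∀ v, ν v ≤ M) :
    edgeWeight G μ ν ^ s ≤ s ^ 2 * ∑ v, μ v ^ 2 + r * M := by
  classical
  have hprod : ∀ u : Fin s → V, 0 ≤ ∏ k, μ (u k) := fun u => Finset.prod_nonneg fun k _ => hμ0 _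
  have hinj : ∀ u : Fin s → V, Function.Injective u →
      ∑ v with ∀ k, G.Adj (u k) v, ν v ≤ r * M := by
    intro u hu
    have hcard : #{v | ∀ k, G.Adj (u k) v} ≤ r := by
      simpa using (card_common_neighbors_lt hfree hu).le
    calc ∑ v with ∀ k, G.Adj (u k) v, ν v ≤ #{v | ∀ k, G.Adj (u k) v} • M :=
          Finset.sum_le_card_nsmul _ _ _ fun v _ => hM v
      _ ≤ r * M := by rw [nsmul_eq_mul]; gcongr
  have hall : ∀ u : Fin s → V, ∑ v with ∀ k, G.Adj (u k) v, ν v ≤ 1 := fun u =>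
    (Finset.sum_le_sum_of_subset_of_nonneg (Finset.filter_subset _ _) fun v _ _ => hν0 v).trans_eq
      hν
  have hterm : ∀ u : Fin s → V, (∏ k, μ (u k)) * ∑ v with ∀ k, G.Adj (u k) v, ν v ≤
      (if ¬ Function.Injective u then ∏ k, μ (u k) else 0) + (∏ k, μ (u k)) * (r * M) := by
    intro u
    by_cases hu : Function.Injective u
    · simpa [hu] using mul_le_mul_of_nonneg_left (hinj u hu) (hprod u)
    · have hle := mul_le_of_le_one_right (hprod u) (hall u)
      have hnonneg : 0 ≤ (∏ k, μ (u k)) * (r * M) := mul_nonneg (hprod u) (by positivity)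
      simpa [hu] using hle.trans (le_add_of_nonneg_right hnonneg)
  have htotal : ∑ u : Fin s → V, ∏ k, μ (u k) = 1 := by
    rw [← Fintype.piFinset_univ, ← Finset.prod_univ_sum (f := fun _ => μ)]
    simp [hμ]
  refine (edgeWeight_pow_le_sum hμ0 hν0 hν s).trans
    ((Finset.sum_le_sum fun u _ => hterm u).trans ?_)
  rw [Finset.sum_add_distrib, ← Finset.sum_filter, ← Finset.sum_mul, htotal, one_mul]
  gcongr
  exact sum_prod_filter_not_injective_le hμ0 hμ

lemma edgeWeight_le_of_sum_eq_one (hfree : (completeBipartiteGraph (Fin s) (Fin r)).Free G)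
    {q : ℝ} (hq : 1 ≤ q) {μ ν : V → ℝ} (hμ0 : ∀ v, 0 ≤ μ v) (hν0 : ∀ v, 0 ≤ ν v)
    (hμ : ∑ v, μ v = 1) (hν : ∑ v, ν v = 1) :
    edgeWeight G μ ν ≤ 1 / q + (2 * (s + r) * q ^ s) ^ 2 * (∑ v, μ v ^ 2 + ∑ v, ν v ^ 2) := by
  have hq0 : 0 < q := one_pos.trans_le hq
  set α := ∑ v, μ v ^ 2
  set β := ∑ v, ν v ^ 2
  have hα0 : 0 ≤ α := Finset.sum_nonneg fun v _ => sq_nonneg _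
  have hβ0 : 0 ≤ β := Finset.sum_nonneg fun v _ => sq_nonneg _
  by_contra! hlt
  -- The edge weight is at most `1`, so the last term is too; by its choice this makes the two
  -- terms of `edgeWeight_pow_le` at most `(1 / q) ^ s / 4` and `(1 / q) ^ s / 2`.
  have hsmall : (2 * (s + r) * q ^ s) ^ 2 * (α + β) ≤ 1 := by
    have hle := edgeWeight_le_mul (G := G) hμ0 hν0
    rw [hμ, hν, one_mul] at hle
    have : 0 < 1 / q := by positivity
    linarith
  have hM : ∀ v, ν v ≤ √β := fun v => Real.le_sqrt_of_sq_le <|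
    Finset.single_le_sum (f := fun v => ν v ^ 2) (fun v _ => sq_nonneg _) (Finset.mem_univ v)
  have hpow := edgeWeight_pow_le hfree hμ0 hν0 hμ hν (Real.sqrt_nonneg β) hM
  have hy : 1 ≤ q ^ s := one_le_pow₀ hq
  have hlower : 1 ≤ q ^ s * edgeWeight G μ ν ^ s := by
    rw [← mul_pow]
    refine one_le_pow₀ ?_
    rw [← div_le_iff₀' hq0]
    exact le_trans (le_add_of_nonneg_right (by positivity)) hlt.le
  have hsα : 4 * (q ^ s * (s ^ 2 * α)) ≤ 1 := by
    calc 4 * (q ^ s * (s ^ 2 * α)) = (2 * (s + 0)) ^ 2 * (q ^ s * 1) * (α + 0) := by ring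
      _ ≤ (2 * (s + r)) ^ 2 * (q ^ s * q ^ s) * (α + β) := by gcongr; positivity
      _ = (2 * (s + r) * q ^ s) ^ 2 * (α + β) := by ring
      _ ≤ 1 := hsmall
  have hrβ : 2 * (q ^ s * (r * √β)) ≤ 1 := by
    refine (sq_le_one_iff₀ (by positivity)).1 ?_
    calc (2 * (q ^ s * (r * √β))) ^ 2 = (2 * (0 + r) * q ^ s) ^ 2 * (0 + √β ^ 2) := by ring
      _ ≤ (2 * (s + r) * q ^ s) ^ 2 * (α + β) := by
          rw [Real.sq_sqrt hβ0]
          gcongr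
          positivity
      _ ≤ 1 := hsmall
  have hupper := mul_le_mul_of_nonneg_left hpow (zero_le_one.trans hy)
  linarith

theorem edgeWeight_le (hfree : (completeBipartiteGraph (Fin s) (Fin r)).Free G) {q : ℝ}
    (hq : 1 ≤ q) {μ ν : V → ℝ} (hμ0 : ∀ v, 0 ≤ μ v) (hν0 : ∀ v, 0 ≤ ν v) {w : ℝ}
    (hμ : ∑ v, μ v = w) (hν : ∑ v, ν v = w) :
    edgeWeight G μ ν
      ≤ w ^ 2 / q + (2 * (s + r) * q ^ s) ^ 2 * (∑ v, μ v ^ 2 + ∑ v, ν v ^ 2) := by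
  have hw : 0 ≤ w := hμ ▸ Finset.sum_nonneg fun v _ => hμ0 v
  rcases hw.eq_or_lt with rfl | hw
  · have hle := edgeWeight_le_mul (G := G) hμ0 hν0
    rw [hμ, hν, mul_zero] at hle
    exact hle.trans (by positivity)
  have hnormalized := edgeWeight_le_of_sum_eq_one hfree hq (μ := w⁻¹ • μ) (ν := w⁻¹ • ν)
    (fun v => mul_nonneg (inv_nonneg.2 hw.le) (hμ0 v))
    (fun v => mul_nonneg (inv_nonneg.2 hw.le) (hν0 v))
    (by simp [← Finset.mul_sum, hμ, hw.ne']) (by simp [← Finset.mul_sum, hν, hw.ne'])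
  simp only [edgeWeight_smul, Pi.smul_apply, smul_eq_mul, mul_pow, ← Finset.mul_sum, ← mul_add]
    at hnormalized
  calc edgeWeight G μ ν = w ^ 2 * (w⁻¹ ^ 2 * edgeWeight G μ ν) := by field_simp
    _ ≤ w ^ 2 * _ := mul_le_mul_of_nonneg_left hnormalized (sq_nonneg w)
    _ = _ := by field_simp

end KovariSosTuran

section Chords

variable {V : Type*} [Fintype V] [DecidableEq V] {A : Matrix V V ℝ}

lemma sum_sq_mul (hA : A.IsSymm) (i j : ℕ) :
    ∑ a, ∑ b, ∑ u, ((A ^ i) a u * (A ^ j) u b) ^ 2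
      = ∑ u, (A ^ (2 * i)) u u * (A ^ (2 * j)) u u := by
  calc ∑ a, ∑ b, ∑ u, ((A ^ i) a u * (A ^ j) u b) ^ 2
      = ∑ u, ∑ a, ∑ b, ((A ^ i) a u * (A ^ j) u b) ^ 2 := Finset.sum_comm_cycle
    _ = ∑ u, (A ^ (2 * i)) u u * (A ^ (2 * j)) u u := by
        simp_rw [diag_pow_two_mul hA, Finset.sum_mul_sum, mul_pow, (hA.pow i).apply]

lemma sum_adj_pow_mul_pow_eq (hA : A.IsSymm) (G : SimpleGraph V) [DecidableRel G.Adj]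
    (i j i' j' : ℕ) :
    ∑ u, ∑ v with G.Adj u v, (A ^ (i + j)) u v * (A ^ (i' + j')) v u
      = ∑ a, ∑ b, edgeWeight G (fun u => (A ^ i) a u * (A ^ i') u b)
          (fun v => (A ^ j) a v * (A ^ j') v b) := by
  have hentry : ∀ u v, (A ^ (i + j)) u v * (A ^ (i' + j')) v u
      = ∑ a, ∑ b, (A ^ i) a u * (A ^ i') u b * ((A ^ j) a v * (A ^ j') v b) := by
    intro u v
    rw [pow_add, add_comm i', pow_add, Matrix.mul_apply, Matrix.mul_apply, Finset.sum_mul_sum]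
    refine Finset.sum_congr rfl fun a _ => Finset.sum_congr rfl fun b _ => ?_
    rw [(hA.pow i).apply u a, (hA.pow i').apply b u]
    ring
  simp_rw [edgeWeight, hentry]
  rw [Finset.sum_comm_cycle]
  exact Finset.sum_congr rfl fun u _ => Finset.sum_comm_cycle.symm

theorem sum_adj_pow_mul_pow_le (hA : A.IsSymm) (hA0 : ∀ a b, 0 ≤ A a b) {d : ℝ}
    (hd : ∀ v, (A ^ 2) v v ≤ d) {G : SimpleGraph V} [DecidableRel G.Adj] {s r : ℕ}
    (hfree : (completeBipartiteGraph (Fin s) (Fin r)).Free G) {q : ℝ} (hq : 1 ≤ q) {m m' k : ℕ}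
    (hm : 2 ≤ m) (hm' : 2 ≤ m') (hk : m + m' = 2 * (k + 1)) :
    ∑ u, ∑ v with G.Adj u v, (A ^ m) u v * (A ^ m') v u
      ≤ (A ^ (2 * (k + 1))).trace / q
        + 2 * (2 * (s + r) * q ^ s) ^ 2 * (d * (A ^ (2 * k)).trace) := by
  -- The ends of the chord are at distances `i` and `j` from the position of `a`, at distances
  -- `i'` and `j'` from that of `b`.
  obtain ⟨i, j, i', j', hi, hj, hi', hj', rfl, rfl, hii', hjj'⟩ : ∃ i j i' j' : ℕ,
      1 ≤ i ∧ 1 ≤ j ∧ 1 ≤ i' ∧ 1 ≤ j' ∧ m = i + j ∧ m' = i' + j' ∧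
      i + i' = k + 1 ∧ j + j' = k + 1 := by
    by_cases h : m ≤ k + 1
    · exact ⟨1, m - 1, k, k + 1 - (m - 1), by omega⟩
    · exact ⟨k, m - k, 1, k + 1 - (m - k), by omega⟩
  have hnonneg := fun n => Matrix.pow_apply_nonneg hA0 n
  have hedge : ∀ a b, edgeWeight G (fun u => (A ^ i) a u * (A ^ i') u b)
      (fun v => (A ^ j) a v * (A ^ j') v b) ≤ _ := fun a b =>
    edgeWeight_le hfree hq (fun u => mul_nonneg (hnonneg i a u) (hnonneg i' u b))
      (fun v => mul_nonneg (hnonneg j a v) (hnonneg j' v b)) (w := (A ^ (k + 1)) a b)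
      (by rw [← hii', pow_add, Matrix.mul_apply]) (by rw [← hjj', pow_add, Matrix.mul_apply])
  rw [sum_adj_pow_mul_pow_eq hA]
  refine (Finset.sum_le_sum fun a _ => Finset.sum_le_sum fun b _ => hedge a b).trans ?_
  simp_rw [Finset.sum_add_distrib, ← Finset.mul_sum, ← Finset.sum_div, Finset.sum_add_distrib]
  rw [sum_sq_mul hA, sum_sq_mul hA, ← trace_pow_two_mul hA]
  have hdegenerate := mul_le_mul_of_nonneg_left
    (add_le_add (sum_diag_pow_even_mul_le hA hd hi hi' hii')
      (sum_diag_pow_even_mul_le hA hd hj hj' hjj')) (sq_nonneg (2 * (s + r) * q ^ s))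
  linarith

end Chords

section Homomorphisms

variable {V W : Type*} [Fintype V] [DecidableEq V] {G : SimpleGraph V} [DecidableRel G.Adj]
  {H : SimpleGraph W} [Fintype (H →g G)] {i j : W}

lemma card_hom_apply_eq_le (p : H.Walk i j) (q : H.Walk j i)
    (hcover : ∀ x, x ∈ p.support ∨ x ∈ q.support) (u v : V) :
    (#{φ : H →g G | φ i = u ∧ φ j = v} : ℝ)
      ≤ (G.adjMatrix ℝ ^ p.length) u v * (G.adjMatrix ℝ ^ q.length) v u := by
  rw [SimpleGraph.adjMatrix_pow_apply_eq_card_walk, SimpleGraph.adjMatrix_pow_apply_eq_card_walk,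
    ← Nat.cast_mul, ← Fintype.card_prod, ← Fintype.card_subtype]
  let images : {φ : H →g G // φ i = u ∧ φ j = v} →
      {p' : G.Walk u v | p'.length = p.length} × {q' : G.Walk v u | q'.length = q.length} :=
    fun φ => (⟨(p.map φ.1).copy φ.2.1 φ.2.2, by simp⟩, ⟨(q.map φ.1).copy φ.2.2 φ.2.1, by simp⟩)
  refine Nat.cast_le.2 (Fintype.card_le_of_injective images fun φ ψ h => ?_)
  have hp : ∀ x ∈ p.support, φ.1 x = ψ.1 x := by
    simpa [images, List.map_inj_left] using congrArg (fun z => z.1.1.support) h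
  have hq : ∀ x ∈ q.support, φ.1 x = ψ.1 x := by
    simpa [images, List.map_inj_left] using congrArg (fun z => z.2.1.support) h
  exact Subtype.ext (RelHom.ext fun x => (hcover x).elim (hp x) (hq x))

lemma card_hom_rel_le (p : H.Walk i j) (q : H.Walk j i)
    (hcover : ∀ x, x ∈ p.support ∨ x ∈ q.support) (R : V → V → Prop) [DecidableRel R] :
    (#{φ : H →g G | R (φ i) (φ j)} : ℝ)
      ≤ ∑ u, ∑ v with R u v, (G.adjMatrix ℝ ^ p.length) u v * (G.adjMatrix ℝ ^ q.length) v u := by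
  classical
  have hsub : ({φ | R (φ i) (φ j)} : Finset (H →g G)) ⊆
      Finset.univ.biUnion fun u => ({v | R u v} : Finset V).biUnion fun v =>
        {φ | φ i = u ∧ φ j = v} := by
    intro φ hφ
    simpa using hφ
  calc (#{φ : H →g G | R (φ i) (φ j)} : ℝ)
      ≤ ∑ u, ∑ v with R u v, (#{φ : H →g G | φ i = u ∧ φ j = v} : ℝ) := by
        exact_mod_cast (Finset.card_le_card hsub).trans (Finset.card_biUnion_le.trans
          (Finset.sum_le_sum fun u _ => Finset.card_biUnion_le))
    _ ≤ _ := Finset.sum_le_sum fun u _ => Finset.sum_le_sum fun v _ =>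
        card_hom_apply_eq_le p q hcover u v

end Homomorphisms

section CycleGraph

lemma cycleGraph_adj_iff_of_lt {n : ℕ} {i j : Fin n} (hij : i < j) :
    (SimpleGraph.cycleGraph n).Adj i j ↔ (j : ℕ) - i = 1 ∨ (j : ℕ) - i + 1 = n := by
  rw [SimpleGraph.cycleGraph_adj', Fin.coe_sub_iff_lt.2 hij, Fin.coe_sub_iff_le.2 hij.le]
  omega

lemma exists_cycleGraph_walk_of_le {n : ℕ} {i j : Fin n} (hij : i ≤ j) :
    ∃ p : (SimpleGraph.cycleGraph n).Walk i j,
      p.length = (j : ℕ) - i ∧ ∀ x, i ≤ x → x ≤ j → x ∈ p.support := by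
  obtain ⟨b, hb⟩ := j
  change (i : ℕ) ≤ b at hij
  induction b, hij using Nat.le_induction with
  | base => exact ⟨.nil, by simp, fun x hix hxi => by simpa using le_antisymm hxi hix⟩
  | succ b hib ih =>
    obtain ⟨p, hlen, hsupp⟩ := ih (by omega)
    have hadj : (SimpleGraph.cycleGraph n).Adj ⟨b, by omega⟩ ⟨b + 1, hb⟩ :=
      (cycleGraph_adj_iff_of_lt (Fin.mk_lt_mk.2 b.lt_succ_self)).2 (Or.inl (by simp))
    refine ⟨p.concat hadj, by simp [hlen]; omega, fun x hix hxb => ?_⟩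
    rw [SimpleGraph.Walk.support_concat, List.mem_append]
    rcases hxb.lt_or_eq with hlt | rfl
    · exact Or.inl (hsupp x hix (Nat.lt_succ_iff.1 hlt))
    · exact Or.inr (List.mem_singleton_self _)

lemma exists_cycleGraph_walks {n : ℕ} {i j : Fin n} (hij : i < j) :
    ∃ (p : (SimpleGraph.cycleGraph n).Walk i j) (q : (SimpleGraph.cycleGraph n).Walk j i),
      p.length = (j : ℕ) - i ∧ q.length = n - ((j : ℕ) - i) ∧
        ∀ x, x ∈ p.support ∨ x ∈ q.support := by
  obtain ⟨n, rfl⟩ : ∃ m, n = m + 1 := ⟨n - 1, by omega⟩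
  obtain ⟨p, hp, hp_supp⟩ := exists_cycleGraph_walk_of_le hij.le
  obtain ⟨q, hq, hq_supp⟩ := exists_cycleGraph_walk_of_le (Fin.le_last j)
  obtain ⟨q', hq', hq'_supp⟩ := exists_cycleGraph_walk_of_le (Fin.zero_le i)
  have hlt : (0 : Fin (n + 1)) < Fin.last n := (Fin.zero_le i).trans_lt (hij.trans_le j.le_last)
  have hclose : (SimpleGraph.cycleGraph (n + 1)).Adj 0 (Fin.last n) :=
    (cycleGraph_adj_iff_of_lt hlt).2 (Or.inr (by simp))
  refine ⟨p, q.append (.cons hclose.symm q'), hp, ?_, fun x => ?_⟩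
  · simp only [SimpleGraph.Walk.length_append, SimpleGraph.Walk.length_cons, hq, hq', Fin.val_last,
      Fin.val_zero]
    omega
  · simp only [SimpleGraph.Walk.mem_support_append_iff, SimpleGraph.Walk.support_cons,
      List.mem_cons]
    rcases le_or_gt x i with hxi | hix
    · exact Or.inr (Or.inr (Or.inr (hq'_supp x (Fin.zero_le x) hxi)))
    rcases le_or_gt x j with hxj | hjx
    · exact Or.inl (hp_supp x hix.le hxj)
    · exact Or.inr (Or.inl (hq_supp x hjx.le x.le_last))

/-- The homomorphic cycle traced out by a closed walk. -/
def homCycleOfWalk {V : Type*} {G : SimpleGraph V} {n : ℕ} {u : V} (p : G.Walk u u)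
    (hp : p.length = n) : HomCycle G n where
  toFun i := p.getVert i
  map_rel' := by
    have hlt : ∀ i j : Fin n, i < j → (SimpleGraph.cycleGraph n).Adj i j →
        G.Adj (p.getVert i) (p.getVert j) := by
      intro i j hij hadj
      rcases (cycleGraph_adj_iff_of_lt hij).1 hadj with h | h
      · rw [show (j : ℕ) = i + 1 by omega]
        exact p.adj_getVert_succ (by omega)
      · have hclose := p.adj_getVert_succ (i := j) (by omega)
        rw [p.getVert_of_length_le (i := j + 1) (by omega)] at hclose
        rw [show (i : ℕ) = 0 by omega, p.getVert_zero]
        exact hclose.symm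
    intro i j hadj
    rcases lt_or_gt_of_ne hadj.ne with hij | hji
    · exact hlt i j hij hadj
    · exact (hlt j i hji hadj.symm).symm

end CycleGraph

section HomCycle

variable {V : Type*} {G : SimpleGraph V}

/-- The positions `i`, `j` witness that `φ` is not an induced cycle: their images coincide or are
joined by a chord. -/
def HomCycle.IsDegenerateAt {n : ℕ} (φ : HomCycle G n) (i j : Fin n) : Prop :=
  φ i = φ j ∨ G.Adj (φ i) (φ j) ∧ ¬ (SimpleGraph.cycleGraph n).Adj i j

lemma HomCycle.IsDegenerateAt.symm {n : ℕ} {φ : HomCycle G n} {i j : Fin n}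
    (h : φ.IsDegenerateAt i j) : φ.IsDegenerateAt j i :=
  h.imp Eq.symm fun h => ⟨h.1.symm, fun hadj => h.2 hadj.symm⟩

lemma HomCycle.exists_lt_isDegenerateAt {n : ℕ} {φ : HomCycle G n} (hφ : ¬ φ.IsInduced) :
    ∃ i j : Fin n, i < j ∧ φ.IsDegenerateAt i j := by
  obtain ⟨i, j, hij, h⟩ : ∃ i j : Fin n, i ≠ j ∧ φ.IsDegenerateAt i j := by
    rw [HomCycle.IsInduced, not_and_or, Function.not_injective_iff] at hφ
    rcases hφ with ⟨i, j, h, hij⟩ | h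
    · exact ⟨i, j, hij, Or.inl h⟩
    · push Not at h
      obtain ⟨i, j, hadj, hchord⟩ := h
      exact ⟨i, j, fun hij => G.loopless.irrefl _ (hij ▸ hadj), Or.inr ⟨hadj, hchord⟩⟩
  rcases lt_or_gt_of_ne hij with hij | hji
  · exact ⟨i, j, hij, h⟩
  · exact ⟨j, i, hji, h.symm⟩

variable [Fintype V] [DecidableEq V] [DecidableRel G.Adj]

lemma trace_pow_le_card_homCycle {n : ℕ} (hn : 0 < n) [Fintype (HomCycle G n)] :
    (G.adjMatrix ℝ ^ n).trace ≤ Fintype.card (HomCycle G n) := by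
  simp_rw [Matrix.trace, Matrix.diag, SimpleGraph.adjMatrix_pow_apply_eq_card_walk]
  rw [← Nat.cast_sum, ← Fintype.card_sigma]
  refine Nat.cast_le.2 (Fintype.card_le_of_injective
    (fun z : Σ v, {p : G.Walk v v | p.length = n} => homCycleOfWalk z.2.1 z.2.2) ?_)
  rintro ⟨u, p, rfl⟩ ⟨v, q, hq⟩ h
  have hget : ∀ i < p.length, p.getVert i = q.getVert i := fun i hi =>
    DFunLike.congr_fun h ⟨i, hi⟩
  obtain rfl : u = v := by simpa using hget 0 hn
  obtain rfl : p = q := by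
    refine SimpleGraph.Walk.ext_getVert_le_length hq.symm fun i hi => ?_
    rcases hi.lt_or_eq with hlt | rfl
    · exact hget i hlt
    · rw [p.getVert_length, q.getVert_of_length_le hq.le]
  rfl

lemma adjMatrix_sq_apply_self (v : V) : (G.adjMatrix ℝ ^ 2) v v = G.degree v := by
  rw [sq, SimpleGraph.adjMatrix_mul_self_apply_self]

lemma card_homCycle_apply_eq_le {k : ℕ} [Fintype (HomCycle G (2 * (k + 1)))]
    {i j : Fin (2 * (k + 1))} (hij : i < j) :
    (#{φ : HomCycle G (2 * (k + 1)) | φ i = φ j} : ℝ)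
      ≤ G.maxDegree * (G.adjMatrix ℝ ^ (2 * k)).trace := by
  obtain ⟨p, q, hp, hq, hcover⟩ := exists_cycleGraph_walks hij
  refine (card_hom_rel_le p q hcover fun u v => u = v).trans ?_
  simp only [Finset.filter_eq, Finset.mem_univ, if_true, Finset.sum_singleton]
  exact sum_diag_pow_mul_diag_pow_le (G.isSymm_adjMatrix)
    (fun v => by rw [adjMatrix_sq_apply_self]; exact_mod_cast G.degree_le_maxDegree v)
    (fun v => by simp) (by omega) (by omega) (by omega)

lemma card_homCycle_chord_le {s r k : ℕ} [Fintype (HomCycle G (2 * (k + 1)))]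
    (hfree : (completeBipartiteGraph (Fin s) (Fin r)).Free G) {q : ℝ} (hq : 1 ≤ q)
    {i j : Fin (2 * (k + 1))} (hij : i < j)
    (hchord : ¬ (SimpleGraph.cycleGraph (2 * (k + 1))).Adj i j) :
    (#{φ : HomCycle G (2 * (k + 1)) | G.Adj (φ i) (φ j)} : ℝ)
      ≤ (G.adjMatrix ℝ ^ (2 * (k + 1))).trace / q
        + 2 * (2 * (s + r) * q ^ s) ^ 2 * (G.maxDegree * (G.adjMatrix ℝ ^ (2 * k)).trace) := by
  rw [cycleGraph_adj_iff_of_lt hij] at hchord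
  obtain ⟨p, p', hp, hp', hcover⟩ := exists_cycleGraph_walks hij
  refine (card_hom_rel_le p p' hcover G.Adj).trans ?_
  exact sum_adj_pow_mul_pow_le (G.isSymm_adjMatrix)
    (fun u v => by rw [SimpleGraph.adjMatrix_apply]; positivity)
    (fun v => by rw [adjMatrix_sq_apply_self]; exact_mod_cast G.degree_le_maxDegree v)
    hfree hq (by omega) (by omega) (by omega)

open Classical in
lemma card_isDegenerateAt_le {s r k : ℕ} [Fintype (HomCycle G (2 * (k + 1)))]
    (hfree : (completeBipartiteGraph (Fin s) (Fin r)).Free G) {q : ℝ} (hq : 1 ≤ q)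
    {i j : Fin (2 * (k + 1))} (hij : i < j) :
    (#{φ : HomCycle G (2 * (k + 1)) | φ.IsDegenerateAt i j} : ℝ)
      ≤ (G.adjMatrix ℝ ^ (2 * (k + 1))).trace / q + (1 + 2 * (2 * (s + r) * q ^ s) ^ 2)
          * (G.maxDegree * (G.adjMatrix ℝ ^ (2 * k)).trace) := by
  have htrace := (isLogConvex_trace_pow (A := G.adjMatrix ℝ) G.isSymm_adjMatrix).nonneg
  have heq := card_homCycle_apply_eq_le (G := G) hij
  by_cases hcycle : (SimpleGraph.cycleGraph (2 * (k + 1))).Adj i j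
  · have hle : #{φ : HomCycle G (2 * (k + 1)) | φ.IsDegenerateAt i j}
        ≤ #{φ : HomCycle G (2 * (k + 1)) | φ i = φ j} :=
      Finset.card_le_card fun φ => by simp [HomCycle.IsDegenerateAt, hcycle]
    have hchord : 0 ≤ (G.adjMatrix ℝ ^ (2 * (k + 1))).trace / q
        + 2 * (2 * (s + r) * q ^ s) ^ 2 * (G.maxDegree * (G.adjMatrix ℝ ^ (2 * k)).trace) :=
      add_nonneg (div_nonneg (htrace _) (by linarith))
        (mul_nonneg (by positivity) (mul_nonneg (by positivity) (htrace _)))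
    have hle' : (#{φ : HomCycle G (2 * (k + 1)) | φ.IsDegenerateAt i j} : ℝ) ≤ _ :=
      (Nat.cast_le.2 hle).trans heq
    linarith
  · have hle : #{φ : HomCycle G (2 * (k + 1)) | φ.IsDegenerateAt i j}
        ≤ #{φ : HomCycle G (2 * (k + 1)) | φ i = φ j}
          + #{φ : HomCycle G (2 * (k + 1)) | G.Adj (φ i) (φ j)} :=
      (Finset.card_le_card fun φ => by simp [HomCycle.IsDegenerateAt, hcycle]).trans
        (Finset.card_union_le _ _)
    have hle' : (#{φ : HomCycle G (2 * (k + 1)) | φ.IsDegenerateAt i j} : ℝ)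
        ≤ #{φ : HomCycle G (2 * (k + 1)) | φ i = φ j}
          + #{φ : HomCycle G (2 * (k + 1)) | G.Adj (φ i) (φ j)} := by exact_mod_cast hle
    have hchord := card_homCycle_chord_le hfree hq hij hcycle
    linarith

open Classical in
theorem card_not_isInduced_le {s r k : ℕ} [Fintype (HomCycle G (2 * (k + 1)))]
    (hfree : (completeBipartiteGraph (Fin s) (Fin r)).Free G) {q : ℝ} (hq : 1 ≤ q) :
    (#{φ : HomCycle G (2 * (k + 1)) | ¬ φ.IsInduced} : ℝ)
      ≤ (2 * (k + 1)) ^ 2 * ((G.adjMatrix ℝ ^ (2 * (k + 1))).trace / q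
        + (1 + 2 * (2 * (s + r) * q ^ s) ^ 2)
          * (G.maxDegree * (G.adjMatrix ℝ ^ (2 * k)).trace)) := by
  have hsub : ({φ | ¬ φ.IsInduced} : Finset (HomCycle G (2 * (k + 1)))) ⊆
      ({z | z.1 < z.2} : Finset (Fin (2 * (k + 1)) × Fin (2 * (k + 1)))).biUnion
        fun z => {φ | φ.IsDegenerateAt z.1 z.2} := by
    intro φ hφ
    obtain ⟨i, j, hij, h⟩ := HomCycle.exists_lt_isDegenerateAt (Finset.mem_filter.1 hφ).2
    exact Finset.mem_biUnion.2 ⟨(i, j), by simpa using hij, by simpa using h⟩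
  have hpairs : #({z | z.1 < z.2} : Finset (Fin (2 * (k + 1)) × Fin (2 * (k + 1))))
      ≤ (2 * (k + 1)) ^ 2 :=
    (Finset.card_le_univ _).trans_eq (by rw [Fintype.card_prod, Fintype.card_fin, sq])
  calc (#{φ : HomCycle G (2 * (k + 1)) | ¬ φ.IsInduced} : ℝ)
      ≤ ∑ z : Fin (2 * (k + 1)) × Fin (2 * (k + 1)) with z.1 < z.2,
          (#{φ : HomCycle G (2 * (k + 1)) | φ.IsDegenerateAt z.1 z.2} : ℝ) := by
        exact_mod_cast (Finset.card_le_card hsub).trans Finset.card_biUnion_le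
    _ ≤ #({z | z.1 < z.2} : Finset (Fin (2 * (k + 1)) × Fin (2 * (k + 1)))) • _ :=
        Finset.sum_le_card_nsmul _ _ _ fun z hz =>
          card_isDegenerateAt_le hfree hq (Finset.mem_filter.1 hz).2
    _ ≤ _ := by
        rw [nsmul_eq_mul]
        gcongr
        · have htrace := (isLogConvex_trace_pow (A := G.adjMatrix ℝ) G.isSymm_adjMatrix).nonneg
          exact add_nonneg (div_nonneg (htrace _) (by linarith))
            (mul_nonneg (by positivity) (mul_nonneg (by positivity) (htrace _)))
        · exact_mod_cast hpairs

end HomCycle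

section AlmostRegular

variable {V : Type*} [Fintype V] {G : SimpleGraph V} [DecidableRel G.Adj]

lemma two_mul_card_edgeFinset_le :
    (2 * #G.edgeFinset : ℝ) ≤ Fintype.card V * G.maxDegree := by
  have hsum : ∑ v, G.degree v ≤ Fintype.card V * G.maxDegree :=
    Finset.sum_le_card_nsmul _ _ _ fun v _ => G.degree_le_maxDegree v
  rw [G.sum_degrees_eq_twice_card_edges] at hsum
  exact_mod_cast hsum

lemma pow_mul_card_le_maxDegree_pow [Nonempty V] {D : ℝ} {l : ℕ} (hl : l ≠ 0) (hD : 0 ≤ D)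
    (he : D * (Fintype.card V : ℝ) ^ (1 + 1 / (l : ℝ)) ≤ 2 * #G.edgeFinset) :
    D ^ l * Fintype.card V ≤ (G.maxDegree : ℝ) ^ l := by
  have hcard : 0 < (Fintype.card V : ℝ) := by exact_mod_cast Fintype.card_pos
  have hroot : D * (Fintype.card V : ℝ) ^ (1 / (l : ℝ)) ≤ G.maxDegree := by
    refine le_of_mul_le_mul_left ?_ hcard
    calc Fintype.card V * (D * (Fintype.card V : ℝ) ^ (1 / (l : ℝ)))
        = D * (Fintype.card V : ℝ) ^ (1 + 1 / (l : ℝ)) := by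
          rw [Real.rpow_add hcard, Real.rpow_one]
          ring
      _ ≤ Fintype.card V * G.maxDegree := he.trans two_mul_card_edgeFinset_le
  have hpow := pow_le_pow_left₀ (by positivity) hroot l
  rwa [mul_pow, one_div, Real.rpow_inv_natCast_pow hcard.le hl] at hpow

lemma minDegree_pow_le_trace_pow [DecidableEq V] [Nonempty V] (k : ℕ) :
    (G.minDegree : ℝ) ^ (2 * k) ≤ (G.adjMatrix ℝ ^ (2 * k)).trace :=
  pow_le_trace_pow G.isSymm_adjMatrix
    (fun u v => by rw [SimpleGraph.adjMatrix_apply]; positivity) (Nat.cast_nonneg _)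
    (fun v => by
      simpa [SimpleGraph.adjMatrix_apply, ← SimpleGraph.neighborFinset_eq_filter] using
        G.minDegree_le_degree v) k

theorem IsAlmostRegular.mul_maxDegree_mul_trace_le [DecidableEq V] [Nonempty V] {K D : ℝ}
    {k : ℕ} (hreg : IsAlmostRegular G K) (hD : 0 ≤ D)
    (he : D * (Fintype.card V : ℝ) ^ (1 + 1 / ((k + 1 : ℕ) : ℝ)) ≤ 2 * #G.edgeFinset) :
    D * (G.maxDegree * (G.adjMatrix ℝ ^ (2 * k)).trace)
      ≤ K ^ 2 * (G.adjMatrix ℝ ^ (2 * (k + 1))).trace :=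
  (isLogConvex_trace_pow G.isSymm_adjMatrix).mul_mul_le_of_pow_le hD (Nat.cast_nonneg _) hreg
    (minDegree_pow_le_trace_pow (k + 1))
    (by simpa using pow_mul_card_le_maxDegree_pow k.succ_ne_zero hD he)

end AlmostRegular

lemma one_sub_le_card_subtype_div_card {α : Type*} [Fintype α] {P : α → Prop} [DecidablePred P]
    {ε T : ℝ} (hT : 0 < T) (hTα : T ≤ Fintype.card α) (hP : (#{a | ¬ P a} : ℝ) ≤ ε * T) :
    1 - ε ≤ (Nat.card {a // P a} : ℝ) / Nat.card α := by
  have hε : 0 ≤ ε := nonneg_of_mul_nonneg_left ((Nat.cast_nonneg _).trans hP) hT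
  have htotal : (#{a | P a} + #{a | ¬ P a} : ℝ) = Fintype.card α := by
    exact_mod_cast Finset.card_filter_add_card_filter_not (s := Finset.univ) P
  rw [Nat.card_eq_fintype_card, Nat.card_eq_fintype_card, Fintype.card_subtype,
    le_div_iff₀ (hT.trans_le hTα)]
  linarith [mul_le_mul_of_nonneg_left hTα hε]

theorem one_sub_le_card_isInduced_div_card_homCycle {V : Type*} [Fintype V] {G : SimpleGraph V}
    [DecidableRel G.Adj] {l s r : ℕ} {K q : ℝ} (hl : 0 < l) (hq : 1 ≤ q)
    (hreg : IsAlmostRegular G K) (hfree : (completeBipartiteGraph (Fin s) (Fin r)).Free G)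
    (he : K ^ 2 * (q * (1 + 2 * (2 * (s + r) * q ^ s) ^ 2))
      * (Fintype.card V : ℝ) ^ (1 + 1 / (l : ℝ)) < 2 * #G.edgeFinset) :
    1 - 8 * l ^ 2 / q ≤ (Nat.card {φ : HomCycle G (2 * l) // φ.IsInduced} : ℝ) /
      (Nat.card (HomCycle G (2 * l)) : ℝ) := by
  classical
  obtain ⟨k, rfl⟩ : ∃ k, l = k + 1 := ⟨l - 1, by omega⟩
  have : Finite (HomCycle G (2 * (k + 1))) := DFunLike.finite _
  have := Fintype.ofFinite (HomCycle G (2 * (k + 1)))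
  have hq0 : 0 < q := one_pos.trans_le hq
  have hedges : 0 < (2 * #G.edgeFinset : ℝ) := he.trans_le' (by positivity)
  have hcardmax := hedges.trans_le two_mul_card_edgeFinset_le
  have hmax : (0 : ℝ) < G.maxDegree := pos_of_mul_pos_right hcardmax (Nat.cast_nonneg _)
  have hKδ : K * G.minDegree ≠ 0 := (hmax.trans_le hreg).ne'
  have hK : 0 < K ^ 2 := by have := left_ne_zero_of_mul hKδ; positivity
  have hδ : (0 : ℝ) < G.minDegree :=
    (Nat.cast_nonneg _).lt_of_ne' (right_ne_zero_of_mul hKδ)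
  have : Nonempty V := Fintype.card_pos_iff.1
    (by exact_mod_cast pos_of_mul_pos_left hcardmax (Nat.cast_nonneg _))
  have htrace := (pow_pos hδ _).trans_le (minDegree_pow_le_trace_pow (G := G) (k + 1))
  refine one_sub_le_card_subtype_div_card htrace (trace_pow_le_card_homCycle (by omega)) ?_
  have hratio := hreg.mul_maxDegree_mul_trace_le (by positivity) he.le
  rw [mul_assoc, mul_le_mul_iff_right₀ hK, mul_assoc, ← le_div_iff₀' hq0] at hratio
  calc (#{φ : HomCycle G (2 * (k + 1)) | ¬ φ.IsInduced} : ℝ)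
      ≤ _ := card_not_isInduced_le hfree hq
    _ ≤ (2 * (k + 1)) ^ 2 * ((G.adjMatrix ℝ ^ (2 * (k + 1))).trace / q
        + (G.adjMatrix ℝ ^ (2 * (k + 1))).trace / q) := by gcongr
    _ = 8 * ((k + 1 : ℕ) : ℝ) ^ 2 / q * (G.adjMatrix ℝ ^ (2 * (k + 1))).trace := by
        push_cast
        ring

lemma one_add_mul_sq_le_mul_pow {x : ℝ} (hx : 4 ≤ x) (s : ℕ) :
    1 + 2 * (2 * (s + s) * (16 * x ^ 2) ^ s) ^ 2 ≤ 33 * x ^ (20 * s) := by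
  have hs : (s : ℝ) ^ 2 ≤ x ^ s := by
    have hlt : (s : ℝ) ≤ 2 ^ s := by exact_mod_cast Nat.lt_two_pow_self.le
    calc (s : ℝ) ^ 2 ≤ (2 ^ s) ^ 2 := by gcongr
      _ = 4 ^ s := by rw [← pow_mul, mul_comm, pow_mul]; norm_num
      _ ≤ x ^ s := by gcongr
  have hq : 16 * x ^ 2 ≤ x ^ 4 := by
    calc 16 * x ^ 2 = 4 ^ 2 * x ^ 2 := by ring
      _ ≤ x ^ 2 * x ^ 2 := by gcongr
      _ = x ^ 4 := by ring
  have hx1 : 1 ≤ x := by linarith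
  calc 1 + 2 * (2 * (s + s) * (16 * x ^ 2) ^ s) ^ 2
      = 1 + 32 * ((s : ℝ) ^ 2 * ((16 * x ^ 2) ^ s) ^ 2) := by ring
    _ ≤ 1 + 32 * (x ^ s * ((x ^ 4) ^ s) ^ 2) := by gcongr
    _ = 1 + 32 * x ^ (9 * s) := by ring
    _ ≤ x ^ (20 * s) + 32 * x ^ (20 * s) := by
        gcongr
        · exact one_le_pow₀ hx1
        · norm_num
    _ = 33 * x ^ (20 * s) := by ring

theorem mainTheorem7_general (l t : ℕ) (hl : 2 ≤ l) (ht : 2 ≤ t) (K : ℝ) :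
    ∃ C : ℝ, 0 < C ∧
      ∀ (s : ℕ) (V : Type*) [Fintype V] (G : SimpleGraph V) [DecidableRel G.Adj],
        IsAlmostRegular G K →
        (completeBipartiteGraph (Fin s) (Fin s)).Free G →
        C * ((l : ℝ) * t) ^ (20 * s) * (Fintype.card V : ℝ) ^ (1 + 1 / (l : ℝ))
          < #G.edgeFinset →
        1 - 1 / (2 * (t : ℝ) ^ 2) ≤
          (Nat.card {φ : HomCycle G (2 * l) // φ.IsInduced} : ℝ) /
            (Nat.card (HomCycle G (2 * l)) : ℝ) := by
  set x : ℝ := l * t with hx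
  have hl' : (2 : ℝ) ≤ l := by exact_mod_cast hl
  have ht' : (2 : ℝ) ≤ t := by exact_mod_cast ht
  have hx4 : 4 ≤ x := by nlinarith
  refine ⟨264 * (K ^ 2 + 1) * x ^ 2, by positivity, fun s V _ G _ hreg hfree he => ?_⟩
  have hε : 8 * (l : ℝ) ^ 2 / (16 * x ^ 2) = 1 / (2 * t ^ 2) := by
    rw [hx]
    field_simp
    norm_num
  rw [← hε]
  refine one_sub_le_card_isInduced_div_card_homCycle (by omega) (by nlinarith) hreg hfree ?_
  calc K ^ 2 * (16 * x ^ 2 * (1 + 2 * (2 * (s + s) * (16 * x ^ 2) ^ s) ^ 2))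
        * (Fintype.card V : ℝ) ^ (1 + 1 / (l : ℝ))
      ≤ (K ^ 2 + 1) * (16 * x ^ 2 * (33 * x ^ (20 * s)))
        * (Fintype.card V : ℝ) ^ (1 + 1 / (l : ℝ)) := by
        gcongr
        · exact le_add_of_nonneg_right zero_le_one
        · exact one_add_mul_sq_le_mul_pow hx4 s
    _ = 2 * (264 * (K ^ 2 + 1) * x ^ 2 * x ^ (20 * s)
        * (Fintype.card V : ℝ) ^ (1 + 1 / (l : ℝ))) := by ring
    _ < 2 * #G.edgeFinset := by gcongr

theorem mainTheorem7 (l t : ℕ) (hl : 2 ≤ l) (ht : 2 ≤ t) :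
    ∃ C : ℝ, 0 < C ∧
      ∀ (s n : ℕ) (V : Type*) [Fintype V] [DecidableEq V]
        (G : SimpleGraph V) [DecidableRel G.Adj],
        Fintype.card V = n →
        IsAlmostRegular G ((2 : ℝ) ^ (4 * l + 2)) →
        (completeBipartiteGraph (Fin s) (Fin s)).Free G →
        (G.edgeFinset.card : ℝ) >
          C * ((l : ℝ) * (t : ℝ)) ^ (20 * s) * (n : ℝ) ^ (1 + 1 / (l : ℝ)) →
        1 - 1 / (2 * (t : ℝ) ^ 2) ≤
          (Nat.card {φ : HomCycle G (2 * l) // φ.IsInduced} : ℝ) /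
            (Nat.card (HomCycle G (2 * l)) : ℝ) := by
  obtain ⟨C, hC, hbound⟩ := mainTheorem7_general l t hl ht (2 ^ (4 * l + 2))
  exact ⟨C, hC, fun s n V _ _ G _ hn => hn ▸ hbound s V G⟩
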